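/- Let $k$ be a perfect field of characteristic $2$ (for instance $k=\mathbb{F}_q$ with $q$ a power of $2$, or $k=\overline{\mathbb{F}}_q$), and let $A,B\in k[t]$ be polynomials of odd degree. Then the affine curve $$r^2+r=A(t),\qquad s^2+s=rA(t)+B(t)$$ over $k$ is integral, i.e. $k[t,r,s]/(r^2+r-A,\ s^2+s-rA-B)$ is an integral domain, and the smooth projective curve $C$ over $k$ whose function field is the fraction field $k(t,r,s)$ of this ring has genus $$g(C)=\max\left\{\frac{5\deg A-3}{2},\ \frac{2\deg B+\deg A-3}{2}\right\}.$$ Here the genus is the dimension over $k$ of the space of everywhere regular differentials on $C$. -/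

import Mathlib

open Polynomial

noncomputable section

namespace ArtinSchreierQuartic

/-- A Kähler differential `ω` of `F / k` is regular at the valuation ring `O` if it lies in the
`O`-submodule of `Ω[F⁄k]` generated by the differentials `dx`, `x ∈ O`, i.e. in the image of
`Ω[O⁄k]`. -/
def IsRegularAt (k F : Type*) [Field k] [Field F] [Algebra k F] (O : ValuationSubring F)
    (ω : Ω[F⁄k]) : Prop :=
  ω ∈ Submodule.span O.toSubring (KaehlerDifferential.D k F '' (O : Set F))

/-- The `k`-vector space of everywhere regular differentials of `F / k`. When `F` is the function
field of a smooth projective curve `X` over `k`, the local rings of `X` are exactly the valuation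
rings of `F` that contain `k` (the ring `O = ⊤` belongs to the generic point and imposes no
condition), so this is the space of global sections of the sheaf of differentials of `X / k`. -/
def regularDifferentials (k F : Type*) [Field k] [Field F] [Algebra k F] :
    Submodule k (Ω[F⁄k]) where
  carrier := {ω | ∀ O : ValuationSubring F, (∀ c : k, algebraMap k F c ∈ O) →
    IsRegularAt k F O ω}
  zero_mem' := fun _ _ => Submodule.zero_mem _
  add_mem' := fun ha hb O hO => Submodule.add_mem _ (ha O hO) (hb O hO)
  smul_mem' := fun c ω hω O hO => by
    have h := Submodule.smul_mem _ (⟨algebraMap k F c, hO c⟩ : O.toSubring) (hω O hO)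
    have e : (⟨algebraMap k F c, hO c⟩ : O.toSubring) • ω = c • ω :=
      algebraMap_smul F c ω
    rw [e] at h
    exact h

/-- The genus of a function field `F` of one variable over a perfect field `k`, that is, of the
smooth projective curve over `k` with function field `F`: the dimension of the space of everywhere
regular differentials. -/
def genus (k F : Type*) [Field k] [Field F] [Algebra k F] : ℕ :=
  Module.finrank k (regularDifferentials k F)

variable {k : Type*} [Field k]

/-- The coordinate ring `k[t, r] / (r² + r - A(t))` of the affine curve `H`. -/
abbrev CoordRingH (A : k[X]) : Type _ :=
  AdjoinRoot (X ^ 2 + X - C A : k[X][X])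

/-- The function `r` on `H`. -/
abbrev r (A : k[X]) : CoordRingH A := AdjoinRoot.root _

/-- The coordinate ring `k[t, r, s] / (r² + r - A(t), s² + s - (r A(t) + B(t)))` of the affine
curve `C`. -/
abbrev CoordRingC (A B : k[X]) : Type _ :=
  AdjoinRoot (X ^ 2 + X - C (r A * AdjoinRoot.of _ A + AdjoinRoot.of _ B) : (CoordRingH A)[X])

end ArtinSchreierQuartic

end

/-!
Since `k[t, r, s]` is étale over `k[t]`, its module of differentials is free on `dt`, so a regular
differential is `z dt` with `z` in `k[t, r, s]` subject only to a condition at infinity. Writing `B`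
as `U² + V² A + P` with `deg P < deg A`, which is possible because `k` is perfect of characteristic
two and `deg A` is odd, the substitution `s ↦ s + U + V r` turns the second equation into
`s² + s = p + q r` with `deg q = max (deg A) (deg B - deg A)` and `q r` dominating `p` at infinity.
The pole order of the generator is then odd at each stage, so the infinite place of `k(t)` is
totally ramified in this tower, which shows that the ring is a domain.

For the order of `dt` at infinity, note that `s² + s` and `s` have the same derivative. Hence in
passing to a ramified Artin–Schreier extension generated by `s` the common size of the logarithmic
derivatives `(dx/dt) / x` of the elements `x` of odd order is multiplied by the size of `s`. Applied
to a uniformizer this determines the order of `dt`. As the pole orders of `1, r, s, rs` are distinct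
modulo four, the condition on `z` bounds the degree of each of its four coordinates separately, and
the genus is the number of remaining coefficients.
-/

noncomputable section

namespace ArtinSchreierQuartic

section ArtinSchreierOrder

variable {F Γ : Type*} [Field F] [LinearOrderedCommGroupWithZero Γ] {w : Valuation F Γ} {γ : Γ}
  {x : F}

theorem valuation_sq_add_self_of_one_lt (hx : 1 < w x) : w (x ^ 2 + x) = w x ^ 2 := by
  rw [Valuation.map_add_eq_of_lt_left, map_pow]
  rw [map_pow]
  exact lt_self_pow₀ hx one_lt_two

theorem valuation_eq_zpow_of_sq_add_self (hγ : 1 < γ) {n : ℤ} (hn : 0 < n)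
    (h : w (x ^ 2 + x) = γ ^ (2 * n)) : w x = γ ^ n := by
  have hx : 1 < w x := by
    by_contra! hx
    have hle : w (x ^ 2 + x) ≤ 1 := Valuation.map_add_le _ (by
      rw [map_pow]
      exact pow_le_one' hx 2) hx
    rw [h] at hle
    exact hle.not_gt (one_lt_zpow₀ hγ (by positivity))
  rw [valuation_sq_add_self_of_one_lt hx, mul_comm, zpow_mul, zpow_ofNat] at h
  exact (pow_left_inj₀ zero_le zero_le two_ne_zero).mp h

/-- All nonzero elements of `S` have order divisible by `d`, where `x` has order `n` (a pole of
order `n`, if `n` is positive) when `w x = γ ^ n`. Scaling `γ` makes room for ramification. -/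
def OrdersDivisibleBy (w : Valuation F Γ) (γ : Γ) (d : ℤ) (S : Set F) : Prop :=
  ∀ x ∈ S, x ≠ 0 → ∃ n : ℤ, w x = γ ^ (d * n)

/-- The set `S + S s`, which is the ring `S[s]` when `S` is a ring over which `s` is integral of
degree two. -/
def quadraticExtension (S : Set F) (s : F) : Set F := {x | ∃ a ∈ S, ∃ b ∈ S, a + b * s = x}

section Quadratic

variable {d m : ℤ} {S : Set F} {s : F}

theorem OrdersDivisibleBy.mono {T : Set F} (hT : OrdersDivisibleBy w γ d T) (hST : S ⊆ T) :
    OrdersDivisibleBy w γ d S := fun x hx => hT x (hST hx)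

theorem OrdersDivisibleBy.valuation_ne_of_odd (hS : OrdersDivisibleBy w γ (2 * d) S) (hγ : 1 < γ)
    (hd : d ≠ 0) (hm : Odd m) (hx : x ∈ S) : w x ≠ γ ^ (d * m) := by
  intro h
  have hx0 : x ≠ 0 := by
    rw [← w.ne_zero_iff, h]
    exact zpow_ne_zero _ (zero_lt_one.trans hγ).ne'
  obtain ⟨n, hn⟩ := hS x hx hx0
  rw [h, mul_comm 2, mul_assoc] at hn
  have := mul_left_cancel₀ hd (zpow_right_injective₀ (zero_lt_one.trans hγ) hγ.ne' hn)
  exact (Int.not_even_iff_odd.mpr hm) ⟨n, by omega⟩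

theorem OrdersDivisibleBy.exists_odd (hS : OrdersDivisibleBy w γ (2 * d) S) (hγ : 1 < γ)
    (hm : Odd m) (hs : w s = γ ^ (d * m)) {b : F} (hb : b ∈ S) (hb0 : b ≠ 0) :
    ∃ n, Odd n ∧ w (b * s) = γ ^ (d * n) := by
  obtain ⟨n, hn⟩ := hS b hb hb0
  refine ⟨2 * n + m, (even_two_mul n).add_odd hm, ?_⟩
  rw [map_mul, hn, hs, ← zpow_add₀ (zero_lt_one.trans hγ).ne']
  ring_nf

theorem OrdersDivisibleBy.valuation_add_mul (hS : OrdersDivisibleBy w γ (2 * d) S) (hγ : 1 < γ)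
    (hd : d ≠ 0) (hm : Odd m) (hs : w s = γ ^ (d * m)) {a b : F} (ha : a ∈ S) (hb : b ∈ S) :
    w (a + b * s) = max (w a) (w (b * s)) := by
  by_cases hb0 : b = 0
  · simp [hb0]
  obtain ⟨n, hn, hbs⟩ := hS.exists_odd hγ hm hs hb hb0
  exact w.map_add_of_distinct_val (hbs ▸ hS.valuation_ne_of_odd hγ hd hn ha)

theorem OrdersDivisibleBy.quadraticExtension (hS : OrdersDivisibleBy w γ (2 * d) S) (hγ : 1 < γ)
    (hd : d ≠ 0) (hm : Odd m) (hs : w s = γ ^ (d * m)) :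
    OrdersDivisibleBy w γ d (quadraticExtension S s) := by
  rintro _ ⟨a, ha, b, hb, rfl⟩ hx
  rw [← w.ne_zero_iff] at hx
  rw [hS.valuation_add_mul hγ hd hm hs ha hb] at hx ⊢
  rcases max_choice (w a) (w (b * s)) with h | h <;> rw [h] at hx ⊢
  · obtain ⟨n, hn⟩ := hS a ha (w.ne_zero_iff.mp hx)
    exact ⟨2 * n, by rw [hn]; ring_nf⟩
  · obtain ⟨n, -, hn⟩ := hS.exists_odd hγ hm hs hb (left_ne_zero_of_mul (w.ne_zero_iff.mp hx))
    exact ⟨n, hn⟩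

theorem OrdersDivisibleBy.valuation_add_mul_of_odd (hS : OrdersDivisibleBy w γ (2 * d) S)
    (hγ : 1 < γ) (hd : d ≠ 0) (hm : Odd m) (hs : w s = γ ^ (d * m)) {a b : F} (ha : a ∈ S)
    (hb : b ∈ S) {n : ℤ} (hn : Odd n) (hx : w (a + b * s) = γ ^ (d * n)) :
    w (a + b * s) = w (b * s) := by
  rw [hS.valuation_add_mul hγ hd hm hs ha hb] at hx ⊢
  refine max_eq_right (le_of_not_gt fun hlt => ?_)
  rw [max_eq_left hlt.le] at hx
  exact hS.valuation_ne_of_odd hγ hd hn ha hx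

theorem OrdersDivisibleBy.valuation_mul_lt_of_even (hS : OrdersDivisibleBy w γ (2 * d) S)
    (hγ : 1 < γ) (hd : d ≠ 0) (hm : Odd m) (hs : w s = γ ^ (d * m)) {a b : F} (ha : a ∈ S)
    (hb : b ∈ S) {n : ℤ} (hn : Even n) (hx : w (a + b * s) = γ ^ (d * n)) :
    w (b * s) < w (a + b * s) := by
  have hγ0 := zero_lt_one.trans hγ
  by_cases hb0 : b = 0
  · rw [hx, hb0, zero_mul, map_zero]
    exact zpow_pos hγ0 _
  refine lt_of_le_of_ne (hS.valuation_add_mul hγ hd hm hs ha hb ▸ le_max_right _ _) fun h => ?_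
  obtain ⟨l, hl, hbs⟩ := hS.exists_odd hγ hm hs hb hb0
  rw [← h, hbs] at hx
  rw [mul_left_cancel₀ hd (zpow_right_injective₀ hγ0 hγ.ne' hx)] at hl
  exact Int.not_even_iff_odd.mpr hl hn

theorem exists_valuation_eq_zpow_of_odd (hγ : 1 < γ) (hm : Odd m) {u : F}
    (hu : w u = γ ^ (2 * d)) (hs : w s = γ ^ (d * m)) : ∃ x, w x = γ ^ d := by
  obtain ⟨l, rfl⟩ := hm
  refine ⟨s / u ^ l, ?_⟩
  rw [map_div₀, map_zpow₀, hu, hs, ← zpow_mul, ← zpow_sub₀ (zero_lt_one.trans hγ).ne']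
  ring_nf

end Quadratic

theorem OrdersDivisibleBy.of_isFractionRing {R : Type*} [CommRing R] [Algebra R F]
    [IsFractionRing R F] {d : ℤ} (hγ : 1 < γ)
    (h : OrdersDivisibleBy w γ d (Set.range (algebraMap R F))) :
    OrdersDivisibleBy w γ d Set.univ := by
  rintro x - hx
  obtain ⟨y, z, -, rfl⟩ := IsFractionRing.div_surjective (A := R) x
  obtain ⟨m, hm⟩ := h _ ⟨y, rfl⟩ (div_ne_zero_iff.mp hx).1
  obtain ⟨n, hn⟩ := h _ ⟨z, rfl⟩ (div_ne_zero_iff.mp hx).2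
  exact ⟨m - n, by rw [map_div₀, hm, hn, ← zpow_sub₀ (zero_lt_one.trans hγ).ne', mul_sub]⟩

end ArtinSchreierOrder

section LogarithmicDerivative

variable {k F Γ : Type*} [CommRing k] [Field F] [Algebra k F] [LinearOrderedCommGroupWithZero Γ]
  {w : Valuation F Γ} {γ κ : Γ} {δ : Derivation k F F} {d m : ℤ} {S : Set F} {s : F}

theorem derivation_sq_add_self [CharP F 2] (δ : Derivation k F F) (x : F) :
    δ (x ^ 2 + x) = δ x := by
  simp [Derivation.leibniz_pow, CharTwo.two_eq_zero]

theorem derivation_div_eq_div_sq [CharP F 2] (δ : Derivation k F F) (x : F) {y : F} (hy : y ≠ 0) :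
    δ (x / y) = δ (x * y) / y ^ 2 := by
  rw [eq_div_iff (pow_ne_zero 2 hy), show x * y = x / y * y ^ 2 by field_simp, Derivation.leibniz,
    Derivation.leibniz_pow, mul_comm]
  simp [CharTwo.two_eq_zero]

/-- The orders of nonzero elements of `S` are multiples of `d`, and `κ` is the common size of the
logarithmic derivatives `δ x / x` of those `x` in `S` whose order is an odd multiple of `d`; for
even multiples the size is smaller than `κ`. -/
structure HasOddDlogSize (w : Valuation F Γ) (γ : Γ) (δ : Derivation k F F) (d : ℤ) (κ : Γ)
    (S : Set F) : Prop where
  orders : OrdersDivisibleBy w γ d S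
  pos : 0 < κ
  odd : ∀ x ∈ S, ∀ n : ℤ, Odd n → w x = γ ^ (d * n) → w (δ x) = κ * w x
  even : ∀ x ∈ S, ∀ n : ℤ, Even n → w x = γ ^ (d * n) → w (δ x) < κ * w x

namespace HasOddDlogSize

theorem mono {T : Set F} (h : HasOddDlogSize w γ δ d κ T) (hST : S ⊆ T) :
    HasOddDlogSize w γ δ d κ S :=
  ⟨h.orders.mono hST, h.pos, fun x hx => h.odd x (hST hx),
    fun x hx => h.even x (hST hx)⟩

theorem le (h : HasOddDlogSize w γ δ d κ S) {x : F} (hx : x ∈ S) : w (δ x) ≤ κ * w x := by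
  by_cases hx0 : x = 0
  · simp [hx0]
  obtain ⟨n, hn⟩ := h.orders x hx hx0
  exact n.even_or_odd.elim (fun hn' => (h.even x hx n hn' hn).le)
    fun hn' => (h.odd x hx n hn' hn).le

theorem valuation_derivation_sub_lt (h : HasOddDlogSize w γ δ d κ S) (hs : 1 < w s) {a b : F}
    (ha : a ∈ S) (hb : b ∈ S) (hmax : w (a + b * s) = max (w a) (w (b * s))) (hx : a + b * s ≠ 0) :
    w (δ (a + b * s) - b * δ s) < κ * w s * w (a + b * s) := by
  have hκ := h.pos
  have hx' : 0 < w (a + b * s) := zero_lt_iff.mpr (w.ne_zero_iff.mpr hx)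
  have leibniz : δ (a + b * s) - b * δ s = δ a + s * δ b := by
    simp only [map_add, Derivation.leibniz, smul_eq_mul]
    ring
  have hle : w (δ a + s * δ b) ≤ κ * w (a + b * s) := by
    rw [hmax, mul_max]
    refine (Valuation.map_add _ _ _).trans (max_le_max (h.le ha) ?_)
    calc w (s * δ b) = w (δ b) * w s := by rw [map_mul, mul_comm]
      _ ≤ κ * w b * w s := mul_le_mul_left (h.le hb) _
      _ = κ * w (b * s) := by rw [map_mul, mul_assoc]
  calc w (δ (a + b * s) - b * δ s) ≤ κ * w (a + b * s) := leibniz ▸ hle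
    _ < κ * w s * w (a + b * s) := mul_lt_mul_of_pos_right (lt_mul_of_one_lt_right hκ hs) hx'

theorem valuation_derivation_le {M : ℤ} {x : F}
    (h : HasOddDlogSize w γ δ 1 (γ ^ M) Set.univ) (hγ : 1 < γ) (hx : w x ≤ 1) :
    w (δ x) ≤ γ ^ (M - 1) := by
  have hγ0 := zero_lt_one.trans hγ
  by_cases hδ : δ x = 0
  · simp [hδ]
  have hx0 : x ≠ 0 := by
    rintro rfl
    exact hδ (map_zero δ)
  obtain ⟨n, hn⟩ := h.orders x trivial hx0
  obtain ⟨l, hl⟩ := h.orders _ trivial hδ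
  have hn0 : n ≤ 0 := by rwa [hn, one_mul, zpow_le_one_iff_right₀ hγ] at hx
  rw [hl, zpow_le_zpow_iff_right₀ hγ]
  rcases n.even_or_odd with hn' | hn'
  · have hlt := h.even x trivial n hn' hn
    rw [hn, hl, ← zpow_add₀ hγ0.ne', zpow_lt_zpow_iff_right₀ hγ] at hlt
    linarith
  · have heq := h.odd x trivial n hn' hn
    rw [hn, hl, ← zpow_add₀ hγ0.ne'] at heq
    have := zpow_right_injective₀ hγ0 hγ.ne' heq
    obtain ⟨j, rfl⟩ := hn'
    linarith [show j ≤ -1 by omega]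

theorem valuation_derivation_uniformizer {M : ℤ} {x : F}
    (h : HasOddDlogSize w γ δ 1 (γ ^ M) Set.univ) (hγ : 1 < γ) (hx : w x = γ ^ (-1 : ℤ)) :
    w (δ x) = γ ^ (M - 1) := by
  rw [h.odd x trivial (-1) (by decide) (by simpa using hx), hx,
    ← zpow_add₀ (zero_lt_one.trans hγ).ne', sub_eq_add_neg]

variable [CharP F 2]

theorem valuation_derivation_root (h : HasOddDlogSize w γ δ (2 * d) κ S) (hm : Odd m)
    (hs : w s = γ ^ (d * m)) (hs1 : 1 < w s) (hS : s ^ 2 + s ∈ S) : w (δ s) = κ * w s * w s := by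
  have hsq := valuation_sq_add_self_of_one_lt hs1
  have hord : w (s ^ 2 + s) = γ ^ (2 * d * m) := by
    rw [hsq, hs, ← zpow_natCast, ← zpow_mul]
    congr 1
    push_cast
    ring
  rw [← derivation_sq_add_self, h.odd _ hS m hm hord, hsq, sq, mul_assoc]

theorem quadraticExtension (h : HasOddDlogSize w γ δ (2 * d) κ S) (hγ : 1 < γ) (hd : 0 < d)
    (hm : Odd m) (hm0 : 0 < m) (hs : w s = γ ^ (d * m)) (hS : s ^ 2 + s ∈ S) :
    HasOddDlogSize w γ δ d (κ * w s) (quadraticExtension S s) := by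
  have hs1 : 1 < w s := hs ▸ one_lt_zpow₀ hγ (mul_pos hd hm0)
  have hκ : 0 < κ * w s := mul_pos h.pos (zero_lt_one.trans hs1)
  have hbs (b : F) : w (b * δ s) = κ * w s * w (b * s) := by
    rw [map_mul, h.valuation_derivation_root hm hs hs1 hS, map_mul, mul_left_comm]
  have hsub {a b : F} (ha : a ∈ S) (hb : b ∈ S) {n : ℤ} (hx : w (a + b * s) = γ ^ (d * n)) :
      w (δ (a + b * s) - b * δ s) < κ * w s * w (a + b * s) :=
    h.valuation_derivation_sub_lt hs1 ha hb (h.orders.valuation_add_mul hγ hd.ne' hm hs ha hb)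
      (w.ne_zero_iff.mp (hx ▸ zpow_ne_zero _ (zero_lt_one.trans hγ).ne'))
  refine ⟨h.orders.quadraticExtension hγ hd.ne' hm hs, hκ, ?_, ?_⟩
  · rintro _ ⟨a, ha, b, hb, rfl⟩ n hn hx
    have hdom := h.orders.valuation_add_mul_of_odd hγ hd.ne' hm hs ha hb hn hx
    rw [Valuation.map_eq_of_sub_lt (x := b * δ s), hbs, hdom]
    rw [hbs, ← hdom]
    exact hsub ha hb hx
  · rintro _ ⟨a, ha, b, hb, rfl⟩ n hn hx
    have hlt := h.orders.valuation_mul_lt_of_even hγ hd.ne' hm hs ha hb hn hx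
    rw [← sub_add_cancel (δ _) (b * δ s)]
    refine Valuation.map_add_lt _ (hsub ha hb hx) ?_
    rw [hbs]
    exact mul_lt_mul_of_pos_left hlt hκ

theorem of_isFractionRing {R : Type*} [CommRing R] [Algebra R F] [IsFractionRing R F] (hγ : 1 < γ)
    (h : HasOddDlogSize w γ δ d κ (Set.range (algebraMap R F))) :
    HasOddDlogSize w γ δ d κ Set.univ := by
  have : Nontrivial R := (algebraMap R F).domain_nontrivial
  -- In characteristic two `y / z` and `y * z`, which differ by a square, have the same
  -- logarithmic derivative.
  have numerator {x : F} {n : ℤ} (hx : w x = γ ^ (d * n)) : ∃ g ∈ Set.range (algebraMap R F), ∃ z l,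
      w g = γ ^ (d * (n + 2 * l)) ∧ 0 < w z ^ 2 ∧ w x = w g / w z ^ 2 ∧
        w (δ x) = w (δ g) / w z ^ 2 := by
    obtain ⟨y, z, hz, rfl⟩ := IsFractionRing.div_surjective (A := R) x
    have hz0 := IsFractionRing.to_map_ne_zero_of_mem_nonZeroDivisors (K := F) hz
    have hwz := w.ne_zero_iff.mpr hz0
    obtain ⟨l, hl⟩ := h.orders _ ⟨z, rfl⟩ hz0
    have hwx : w (algebraMap R F y / algebraMap R F z) =
        w (algebraMap R F y * algebraMap R F z) / w (algebraMap R F z) ^ 2 := by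
      rw [map_div₀, map_mul, sq, mul_div_mul_right _ _ hwz]
    refine ⟨_, ⟨y * z, map_mul _ _ _⟩, algebraMap R F z, l, ?_,
      pow_pos (zero_lt_iff.mpr hwz) 2, hwx, ?_⟩
    · rw [hwx, eq_comm, eq_div_iff (pow_ne_zero 2 hwz), hl] at hx
      rw [← hx, ← zpow_natCast, ← zpow_mul, ← zpow_add₀ (zero_lt_one.trans hγ).ne']
      congr 1
      push_cast
      ring
    · rw [derivation_div_eq_div_sq δ _ hz0, map_div₀, map_pow]
  refine ⟨h.orders.of_isFractionRing hγ, h.pos, fun x _ n hn hx => ?_, fun x _ n hn hx => ?_⟩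
  · obtain ⟨g, hg, z, l, hgl, -, hxg, hδ⟩ := numerator hx
    rw [hδ, h.odd g hg _ (hn.add_even (even_two_mul l)) hgl, hxg, mul_div_assoc]
  · obtain ⟨g, hg, z, l, hgl, hz, hxg, hδ⟩ := numerator hx
    rw [hδ, hxg, ← mul_div_assoc]
    exact div_lt_div_of_pos_right (h.even g hg _ (hn.add (even_two_mul l)) hgl) hz

end HasOddDlogSize

end LogarithmicDerivative

section Polynomial

theorem degree_derivative_of_odd {R : Type*} [CommRing R] [CharP R 2] {f : R[X]}
    (hf : Odd f.natDegree) : (derivative f).degree = (f.natDegree - 1 : ℕ) := by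
  refine le_antisymm (degree_le_of_natDegree_le (natDegree_derivative_le f))
    (le_degree_of_ne_zero ?_)
  rw [coeff_derivative, ← Nat.cast_add_one, Nat.sub_add_cancel hf.pos,
    CharTwo.natCast_eq_ite, if_neg (Nat.not_even_iff_odd.mpr hf), mul_one, coeff_natDegree]
  exact leadingCoeff_ne_zero.mpr (ne_zero_of_natDegree_gt hf.pos)

theorem natDegree_derivative_lt_of_even {R : Type*} [CommRing R] [CharP R 2] {f : R[X]}
    (hf : Even f.natDegree) (hf' : derivative f ≠ 0) :
    (derivative f).natDegree + 1 < f.natDegree := by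
  have hcoeff := leadingCoeff_ne_zero.mpr hf'
  rw [← coeff_natDegree, coeff_derivative, ← Nat.cast_add_one, CharTwo.natCast_eq_ite] at hcoeff
  refine lt_of_le_of_ne (le_natDegree_of_ne_zero (left_ne_zero_of_mul hcoeff)) fun h => ?_
  rw [h, if_pos hf, mul_zero] at hcoeff
  exact hcoeff rfl

theorem isTrivialOn_of_le_one {k F Γ : Type*} [Field k] [Field F] [Algebra k F]
    [LinearOrderedCommGroupWithZero Γ] {w : Valuation F Γ}
    (hw : ∀ c : k, w (algebraMap k F c) ≤ 1) : w.IsTrivialOn k where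
  eq_one c hc := by
    refine le_antisymm (hw c) ?_
    have h := hw c⁻¹
    rwa [map_inv₀, map_inv₀, inv_le_one₀] at h
    simpa [zero_lt_iff] using hc

theorem mem_degreeLT_div_iff {k : Type*} [Field k] {f : k[X]} {d l n : ℕ} (hd : 0 < d) :
    f ∈ degreeLT k ((l - n) / d) ↔ f = 0 ∨ d * (f.natDegree : ℤ) + n ≤ l - d := by
  rw [mem_degreeLT]
  by_cases hf : f = 0
  · simp [hf]
  · rw [degree_eq_natDegree hf, Nat.cast_lt, Nat.lt_iff_add_one_le,
      Nat.le_div_iff_mul_le hd, Nat.add_one_mul, mul_comm]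
    simp only [hf, false_or]
    omega

variable {k F Γ : Type*} [Field k] [Field F] [Algebra k F] [Algebra k[X] F]
  [IsScalarTower k k[X] F] [LinearOrderedCommGroupWithZero Γ] {w : Valuation F Γ} {γ : Γ} {e : ℤ}

theorem algebraMap_eq_aeval (f : k[X]) : algebraMap k[X] F f = aeval (algebraMap k[X] F X) f := by
  rw [aeval_algebraMap_apply, aeval_X_left_apply]

theorem derivation_algebraMap {δ : Derivation k F F} (hδ : δ (algebraMap k[X] F X) = 1)
    (f : k[X]) : δ (algebraMap k[X] F f) = algebraMap k[X] F (derivative f) := by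
  rw [algebraMap_eq_aeval, Derivation.map_aeval, hδ, smul_eq_mul, mul_one, ← algebraMap_eq_aeval]

variable [w.IsTrivialOn k]

theorem valuation_algebraMap_polynomial (hγ : 1 < γ) (he : 0 < e)
    (ht : w (algebraMap k[X] F X) = γ ^ e) {f : k[X]} (hf : f ≠ 0) :
    w (algebraMap k[X] F f) = γ ^ (e * f.natDegree) := by
  have ht1 : 1 < w (algebraMap k[X] F X) := ht ▸ one_lt_zpow₀ hγ he
  rw [algebraMap_eq_aeval,
    valuation_aeval_eq_valuation_X_pow_natDegree_of_one_lt_valuation_X _ ht1 hf, ht, zpow_mul,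
    zpow_natCast]

theorem ordersDivisibleBy_polynomial (hγ : 1 < γ) (he : 0 < e)
    (ht : w (algebraMap k[X] F X) = γ ^ e) :
    OrdersDivisibleBy w γ e (Set.range (algebraMap k[X] F)) := by
  rintro _ ⟨f, rfl⟩ hf
  exact ⟨f.natDegree, valuation_algebraMap_polynomial hγ he ht (ne_zero_of_map hf)⟩

theorem hasOddDlogSize_polynomial [CharP k 2] {δ : Derivation k F F}
    (hδ : δ (algebraMap k[X] F X) = 1) (hγ : 1 < γ) (he : 0 < e)
    (ht : w (algebraMap k[X] F X) = γ ^ e) :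
    HasOddDlogSize w γ δ e (γ ^ (-e)) (Set.range (algebraMap k[X] F)) := by
  have hγ0 := zero_lt_one.trans hγ
  have order {f : k[X]} {n : ℤ} (hf : w (algebraMap k[X] F f) = γ ^ (e * n)) :
      (f.natDegree : ℤ) = n := by
    have hf0 : algebraMap k[X] F f ≠ 0 :=
      w.ne_zero_iff.mp (hf ▸ zpow_ne_zero _ hγ0.ne')
    rw [valuation_algebraMap_polynomial hγ he ht (ne_zero_of_map hf0)] at hf
    exact mul_left_cancel₀ he.ne' (zpow_right_injective₀ hγ0 hγ.ne' hf)
  refine ⟨ordersDivisibleBy_polynomial hγ he ht, zpow_pos hγ0 _, ?_, ?_⟩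
  · rintro _ ⟨f, rfl⟩ n hn hf
    obtain rfl := order hf
    have hodd : Odd f.natDegree := by exact_mod_cast hn
    have hdeg := degree_derivative_of_odd hodd
    have hf'0 : derivative f ≠ 0 := fun h => by simp [h] at hdeg
    rw [derivation_algebraMap hδ, hf, valuation_algebraMap_polynomial hγ he ht hf'0,
      natDegree_eq_of_degree_eq_some hdeg, ← zpow_add₀ hγ0.ne', Nat.cast_pred hodd.pos]
    ring_nf
  · rintro _ ⟨f, rfl⟩ n hn hf
    obtain rfl := order hf
    rw [derivation_algebraMap hδ, hf, ← zpow_add₀ hγ0.ne']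
    by_cases hf'0 : derivative f = 0
    · rw [hf'0, map_zero, map_zero]
      exact zpow_pos hγ0 _
    have hlt := natDegree_derivative_lt_of_even (by exact_mod_cast hn) hf'0
    rw [valuation_algebraMap_polynomial hγ he ht hf'0, zpow_lt_zpow_iff_right₀ hγ]
    zify at hlt
    nlinarith

end Polynomial

section Infinity

variable {F : Type*} [Field F]

theorem exists_valuation_eq_pow {Γ : Type*} [LinearOrderedCommGroupWithZero Γ] (v : Valuation F Γ)
    {n : ℕ} (hn : n ≠ 0) : ∃ w : Valuation F Γ, ∀ x, w x = v x ^ n :=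
  ⟨v.map (powMonoidWithZeroHom hn) fun _ _ h => pow_le_pow_left₀ zero_le h n, fun _ => rfl⟩

theorem exists_valuationSubring_notMem {R : Type*} [CommRing R] [Algebra R F] {x : F}
    (hx : ¬ IsIntegral R x) :
    ∃ O : ValuationSubring F, (∀ c : R, algebraMap R F c ∈ O) ∧ x ∉ O := by
  obtain ⟨O, hO, hxO⟩ := Subring.exists_le_valuationSubring_of_isIntegrallyClosedIn
    (R := (integralClosure R F).toSubring) hx
  exact ⟨O, fun c => hO isIntegral_algebraMap, hxO⟩

variable {k : Type*} [Field k] [Algebra k F]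

theorem exists_valuation_eq_zpow_of_notMem {O : ValuationSubring F} {x : F} {n : ℕ}
    (hO : ∀ c : k, algebraMap k F c ∈ O) (hx : x ∉ O) (hn : n ≠ 0) :
    ∃ (w : Valuation F O.ValueGroup) (γ : O.ValueGroup), w.IsTrivialOn k ∧ 1 < γ ∧
      w x = γ ^ (n : ℤ) ∧ ∀ y, w y ≤ 1 ↔ y ∈ O := by
  obtain ⟨w, hw⟩ := exists_valuation_eq_pow O.valuation hn
  have le_one_iff (y : F) : w y ≤ 1 ↔ y ∈ O := by
    rw [hw, pow_le_one_iff hn, O.valuation_le_one_iff]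
  refine ⟨w, O.valuation x, isTrivialOn_of_le_one fun c => (le_one_iff _).mpr (hO c), ?_, ?_,
    le_one_iff⟩
  · rwa [← not_le, O.valuation_le_one_iff]
  · rw [hw, zpow_natCast]

variable [Algebra k[X] F] [IsScalarTower k k[X] F]

theorem not_isIntegral_algebraMap_X (hinj : Function.Injective (algebraMap k[X] F)) :
    ¬ IsIntegral k (algebraMap k[X] F X) := by
  rw [← isAlgebraic_iff_isIntegral]
  exact (transcendental_algebraMap_iff hinj).mpr (transcendental_X k)

theorem exists_valuation_X_eq_zpow (hinj : Function.Injective (algebraMap k[X] F))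
    {n : ℕ} (hn : n ≠ 0) :
    ∃ (O : ValuationSubring F) (w : Valuation F O.ValueGroup) (γ : O.ValueGroup),
      w.IsTrivialOn k ∧ 1 < γ ∧ w (algebraMap k[X] F X) = γ ^ (n : ℤ) := by
  obtain ⟨O, hO, ht⟩ := exists_valuationSubring_notMem (not_isIntegral_algebraMap_X hinj)
  obtain ⟨w, γ, hw, hγ, hwt, -⟩ := exists_valuation_eq_zpow_of_notMem hO ht hn
  exact ⟨O, w, γ, hw, hγ, hwt⟩

end Infinity

section Tower

variable {k F Γ : Type*} [Field k] [Field F] [Algebra k[X] F] {A p q : k[X]} {r s : F}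

/-- A biquadratic Artin–Schreier tower `k(t) ⊆ k(t, r) ⊆ k(t, r, s)`, with right hand sides `A(t)`
and `p(t) + q(t) r`, that is totally ramified at infinity: the leading term of `p + q r` there is
that of `q r`, and it cannot be removed by an Artin–Schreier substitution. -/
structure IsReducedTower (A p q : k[X]) (r s : F) : Prop where
  odd : Odd A.natDegree
  ne_zero : q ≠ 0
  natDegree_lt : 2 * p.natDegree < 2 * q.natDegree + A.natDegree
  sq_add_self_left : r ^ 2 + r = algebraMap k[X] F A
  sq_add_self_right : s ^ 2 + s = algebraMap k[X] F p + algebraMap k[X] F q * r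

/-- The basis `1, r, s, rs` of the tower. -/
def towerBasis {R : Type*} [Semiring R] (r s : R) : Fin 4 → R := ![1, r, s, r * s]

/-- The pole orders of `1, r, s, rs` at infinity. -/
def towerPole (A q : k[X]) : Fin 4 → ℕ :=
  ![0, 2 * A.natDegree, 2 * q.natDegree + A.natDegree, 2 * q.natDegree + 3 * A.natDegree]

theorem IsReducedTower.odd_pole_right (h : IsReducedTower A p q r s) :
    Odd (2 * q.natDegree + A.natDegree : ℤ) :=
  (even_two_mul _).add_odd (by exact_mod_cast h.odd)

theorem map_towerBasis {R S : Type*} [Semiring R] [Semiring S] (φ : R →+* S) (r s : R)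
    (i : Fin 4) : φ (towerBasis r s i) = towerBasis (φ r) (φ s) i := by
  fin_cases i <;> simp [towerBasis]

theorem sum_towerBasis_eq {P R : Type*} [CommRing P] [CommRing R] [Algebra P R] (r s : R)
    (f : Fin 4 → P) :
    ∑ i, algebraMap P R (f i) * towerBasis r s i =
      algebraMap P R (f 0) + algebraMap P R (f 1) * r +
        (algebraMap P R (f 2) + algebraMap P R (f 3) * r) * s := by
  simp only [Fin.sum_univ_four, towerBasis, Matrix.cons_val]
  ring

theorem exists_sum_towerBasis_add_eq {P R : Type*} [CommRing P] [CommRing R] [Algebra P R]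
    {c : P} {r : R} (hr : r ^ 2 + r = algebraMap P R c) (s : R) (u v : P) (f : Fin 4 → P) :
    ∃ g : Fin 4 → P, ∑ i, algebraMap P R (g i) *
        towerBasis r (s + (algebraMap P R u + algebraMap P R v * r)) i =
      ∑ i, algebraMap P R (f i) * towerBasis r s i := by
  refine ⟨![f 0 - f 2 * u - f 3 * v * c, f 1 - f 2 * v - f 3 * u + f 3 * v, f 2, f 3], ?_⟩
  simp only [sum_towerBasis_eq, Matrix.cons_val, map_sub, map_add, map_mul]
  linear_combination algebraMap P R (f 3) * algebraMap P R v * hr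

variable [Algebra k F] [IsScalarTower k k[X] F] [LinearOrderedCommGroupWithZero Γ]
  {w : Valuation F Γ} [w.IsTrivialOn k] {γ : Γ}

theorem valuation_root_of_odd (hγ : 1 < γ) (ht : w (algebraMap k[X] F X) = γ ^ (4 : ℤ))
    (hA : Odd A.natDegree) (hr : r ^ 2 + r = algebraMap k[X] F A) :
    w r = γ ^ (2 * A.natDegree : ℤ) := by
  refine valuation_eq_zpow_of_sq_add_self hγ (by simpa using hA.pos) ?_
  rw [hr, valuation_algebraMap_polynomial hγ four_pos ht (ne_zero_of_natDegree_gt hA.pos)]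
  ring_nf

theorem ordersDivisibleBy_quadraticExtension_polynomial (hγ : 1 < γ)
    (ht : w (algebraMap k[X] F X) = γ ^ (4 : ℤ)) (hA : Odd A.natDegree)
    (hr : r ^ 2 + r = algebraMap k[X] F A) :
    OrdersDivisibleBy w γ 2 (quadraticExtension (Set.range (algebraMap k[X] F)) r) :=
  (ordersDivisibleBy_polynomial hγ four_pos ht).quadraticExtension hγ two_ne_zero
    (by exact_mod_cast hA) (valuation_root_of_odd hγ ht hA hr)

theorem valuation_algebraMap_mul_le_iff (hγ : 1 < γ)
    (ht : w (algebraMap k[X] F X) = γ ^ (4 : ℤ)) {f : k[X]} {x : F} {m n : ℤ} (hx : w x = γ ^ m) :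
    w (algebraMap k[X] F f * x) ≤ γ ^ n ↔ f = 0 ∨ 4 * (f.natDegree : ℤ) + m ≤ n := by
  by_cases hf : f = 0
  · simp [hf]
  · rw [map_mul, valuation_algebraMap_polynomial hγ four_pos ht hf, hx,
      ← zpow_add₀ (zero_lt_one.trans hγ).ne', zpow_le_zpow_iff_right₀ hγ]
    simp [hf]

namespace IsReducedTower

variable (h : IsReducedTower A p q r s) (hγ : 1 < γ)
  (ht : w (algebraMap k[X] F X) = γ ^ (4 : ℤ))

include h hγ ht

theorem valuation_left : w r = γ ^ (2 * A.natDegree : ℤ) :=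
  valuation_root_of_odd hγ ht h.odd h.sq_add_self_left

theorem valuation_add_mul :
    w (algebraMap k[X] F p + algebraMap k[X] F q * r) =
      γ ^ (2 * (2 * q.natDegree + A.natDegree) : ℤ) := by
  have hqr : w (algebraMap k[X] F q * r) = γ ^ (2 * (2 * q.natDegree + A.natDegree) : ℤ) := by
    rw [map_mul, valuation_algebraMap_polynomial hγ four_pos ht h.ne_zero,
      h.valuation_left hγ ht, ← zpow_add₀ (zero_lt_one.trans hγ).ne']
    ring_nf
  rw [Valuation.map_add_eq_of_lt_right, hqr]
  rw [hqr]
  by_cases hp : p = 0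
  · rw [hp, map_zero, map_zero]
    exact zpow_pos (zero_lt_one.trans hγ) _
  · rw [valuation_algebraMap_polynomial hγ four_pos ht hp, zpow_lt_zpow_iff_right₀ hγ]
    have := h.natDegree_lt
    omega

theorem valuation_right : w s = γ ^ (2 * q.natDegree + A.natDegree : ℤ) := by
  refine valuation_eq_zpow_of_sq_add_self hγ (by have := h.odd.pos; positivity) ?_
  rw [h.sq_add_self_right, h.valuation_add_mul hγ ht]

theorem valuation_towerBasis (i : Fin 4) : w (towerBasis r s i) = γ ^ (towerPole A q i : ℤ) := by
  have hr := h.valuation_left hγ ht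
  have hs := h.valuation_right hγ ht
  fin_cases i
  · simp [towerBasis, towerPole]
  · simpa [towerBasis, towerPole] using hr
  · simpa [towerBasis, towerPole] using hs
  · simp only [towerBasis, towerPole, Fin.reduceFinMk, Matrix.cons_val, map_mul, hr, hs,
      ← zpow_add₀ (zero_lt_one.trans hγ).ne']
    push_cast
    ring_nf

theorem valuation_sum_le_iff (f : Fin 4 → k[X]) (c : Γ) :
    w (∑ i, algebraMap k[X] F (f i) * towerBasis r s i) ≤ c ↔
      ∀ i, w (algebraMap k[X] F (f i) * towerBasis r s i) ≤ c := by
  have hr := h.valuation_left hγ ht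
  have hs : w s = γ ^ (1 * (2 * q.natDegree + A.natDegree) : ℤ) := by
    rw [one_mul, h.valuation_right hγ ht]
  have hodd : Odd (A.natDegree : ℤ) := by exact_mod_cast h.odd
  have orders₀ := ordersDivisibleBy_polynomial hγ four_pos ht
  have orders₁ := ordersDivisibleBy_quadraticExtension_polynomial hγ ht h.odd h.sq_add_self_left
  have max_left (f g : k[X]) := orders₀.valuation_add_mul (d := 2) hγ two_ne_zero hodd hr
    (Set.mem_range_self f) (Set.mem_range_self g)
  have max_right (f₀ f₁ g₀ g₁ : k[X]) := orders₁.valuation_add_mul (d := 1) hγ one_ne_zero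
    (h.odd_pole_right) hs ⟨_, ⟨f₀, rfl⟩, _, ⟨f₁, rfl⟩, rfl⟩ ⟨_, ⟨g₀, rfl⟩, _, ⟨g₁, rfl⟩, rfl⟩
  rw [sum_towerBasis_eq, max_right, map_mul w _ s, max_left, max_left, max_mul, ← map_mul,
    ← map_mul]
  simp only [max_le_iff, Fin.forall_fin_succ, towerBasis]
  simp [mul_assoc, and_assoc]

theorem linearIndependent : LinearIndependent k[X] (towerBasis r s) := by
  have hγ0 := zero_lt_one.trans hγ
  refine Fintype.linearIndependent_iff.mpr fun f hf i => ?_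
  simp only [Algebra.smul_def] at hf
  have hi := (h.valuation_sum_le_iff hγ ht f 0).mp (by rw [hf, map_zero]) i
  rw [le_zero_iff, map_mul, h.valuation_towerBasis hγ ht, mul_eq_zero_iff_right
    (zpow_ne_zero _ hγ0.ne')] at hi
  by_contra hfi
  rw [valuation_algebraMap_polynomial hγ four_pos ht hfi] at hi
  exact zpow_ne_zero _ hγ0.ne' hi

theorem exists_uniformizer : ∃ π : F, w π = γ ^ (-1 : ℤ) := by
  obtain ⟨x, hx⟩ := exists_valuation_eq_zpow_of_odd (d := 2) hγ (by exact_mod_cast h.odd) ht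
    (h.valuation_left hγ ht)
  obtain ⟨y, hy⟩ := exists_valuation_eq_zpow_of_odd (d := 1) hγ h.odd_pole_right hx
    (by rw [one_mul, h.valuation_right hγ ht])
  exact ⟨y⁻¹, by rw [map_inv₀, hy, ← zpow_neg]⟩

theorem hasOddDlogSize [CharP k 2] {δ : Derivation k F F} (hδ : δ (algebraMap k[X] F X) = 1) :
    HasOddDlogSize w γ δ 1 (γ ^ (2 * q.natDegree + 3 * A.natDegree - 4 : ℤ))
      (quadraticExtension (quadraticExtension (Set.range (algebraMap k[X] F)) r) s) := by
  have := charP_of_injective_algebraMap (algebraMap k F).injective 2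
  have hr := h.valuation_left hγ ht
  have hs := h.valuation_right hγ ht
  have hA := h.odd.pos
  have hodd : Odd (A.natDegree : ℤ) := by exact_mod_cast h.odd
  have dlog₁ := (hasOddDlogSize_polynomial hδ hγ four_pos ht).quadraticExtension (d := 2) hγ
    two_pos hodd (by omega) hr ⟨A, h.sq_add_self_left.symm⟩
  have dlog₂ := dlog₁.quadraticExtension (d := 1) hγ one_pos h.odd_pole_right (by omega)
    (by rw [one_mul, hs]) ⟨_, ⟨p, rfl⟩, _, ⟨q, rfl⟩, h.sq_add_self_right.symm⟩
  convert dlog₂ using 1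
  rw [hr, hs, ← zpow_add₀ (zero_lt_one.trans hγ).ne', ← zpow_add₀ (zero_lt_one.trans hγ).ne']
  ring_nf

end IsReducedTower

end Tower

section Reduction

theorem exists_eq_sq_add_X_mul_sq {k : Type*} [CommRing k] [CharP k 2] [PerfectRing k 2]
    (f : k[X]) : ∃ g h : k[X], f = g ^ 2 + X * h ^ 2 := by
  induction f using Polynomial.induction_on' with
  | add f₁ f₂ h₁ h₂ =>
    obtain ⟨g₁, l₁, rfl⟩ := h₁
    obtain ⟨g₂, l₂, rfl⟩ := h₂
    exact ⟨g₁ + g₂, l₁ + l₂, by rw [CharTwo.add_sq, CharTwo.add_sq]; ring⟩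
  | monomial n c =>
    obtain ⟨c, rfl⟩ := surjective_frobenius k 2 c
    rw [frobenius_def]
    rcases n.even_or_odd with ⟨m, rfl⟩ | ⟨m, rfl⟩
    · exact ⟨monomial m c, 0, by simp [monomial_pow, mul_two]⟩
    · refine ⟨0, monomial m c, ?_⟩
      rw [monomial_pow, X_mul_monomial, mul_comm m]
      simp

section Degree

variable {R : Type*} [CommRing R]

theorem natDegree_add_eq_max {f g : R[X]} (h : f.natDegree ≠ g.natDegree) :
    (f + g).natDegree = max f.natDegree g.natDegree := by
  rcases lt_or_gt_of_ne h with h | h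
  · rw [natDegree_add_eq_right_of_natDegree_lt h, max_eq_right h.le]
  · rw [natDegree_add_eq_left_of_natDegree_lt h, max_eq_left h.le]

variable [IsDomain R]

theorem natDegree_sq_add_X_mul_sq (g : R[X]) {h : R[X]} (hh : h ≠ 0) :
    (g ^ 2 + X * h ^ 2).natDegree = max (2 * g.natDegree) (2 * h.natDegree + 1) := by
  have hg : (g ^ 2).natDegree = 2 * g.natDegree := natDegree_pow g 2
  have hX : (X * h ^ 2).natDegree = 2 * h.natDegree + 1 := by
    rw [natDegree_X_mul (pow_ne_zero 2 hh), natDegree_pow]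
  rw [natDegree_add_eq_max, hg, hX]
  omega

theorem natDegree_le_of_odd_natDegree_sq_add_X_mul_sq {g h : R[X]} {n : ℕ}
    (hn : (g ^ 2 + X * h ^ 2).natDegree = 2 * n + 1) :
    h ≠ 0 ∧ h.natDegree = n ∧ g.natDegree ≤ n := by
  have hh : h ≠ 0 := by
    rintro rfl
    rw [zero_pow two_ne_zero, mul_zero, add_zero, natDegree_pow] at hn
    omega
  rw [natDegree_sq_add_X_mul_sq g hh] at hn
  exact ⟨hh, by omega, by omega⟩

theorem natDegree_add_sq_add {f : R[X]} (hf : Odd f.natDegree) (g : R[X]) :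
    (f + g ^ 2 + g).natDegree = max f.natDegree (2 * g.natDegree) := by
  have hg : (g ^ 2 + g).natDegree = 2 * g.natDegree := by
    rcases Nat.eq_zero_or_pos g.natDegree with h | h
    · rw [eq_C_of_natDegree_eq_zero h, ← C_pow, ← C_add]
      simp
    · rw [natDegree_add_eq_left_of_natDegree_lt] <;> rw [natDegree_pow]
      omega
  obtain ⟨n, hn⟩ := hf
  rw [add_assoc, natDegree_add_eq_max, hg]
  omega

end Degree

theorem natDegree_div_eq_sub {k : Type*} [Field k] (f : k[X]) {g : k[X]} (hg : g ≠ 0) :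
    (f / g).natDegree = f.natDegree - g.natDegree := by
  have hg' := leadingCoeff_ne_zero.mpr hg
  rw [div_def, natDegree_C_mul (inv_ne_zero hg'),
    natDegree_divByMonic _ (monic_mul_leadingCoeff_inv hg), natDegree_mul_C (inv_ne_zero hg')]

variable {k : Type*} [Field k] [CharP k 2] {A B : k[X]}

theorem exists_eq_sq_add_sq_mul_add [PerfectField k] (hA : Odd A.natDegree)
    (hB : Odd B.natDegree) : ∃ U V P : k[X], B = U ^ 2 + V ^ 2 * A + P ∧
      P.natDegree < A.natDegree ∧ 2 * V.natDegree = B.natDegree - A.natDegree ∧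
      2 * U.natDegree ≤ max A.natDegree B.natDegree := by
  have := PerfectField.toPerfectRing (K := k) 2
  obtain ⟨a, ha⟩ := hA
  obtain ⟨b, hb⟩ := hB
  obtain ⟨A₀, A₁, rfl⟩ := exists_eq_sq_add_X_mul_sq A
  obtain ⟨E, D, rfl⟩ := exists_eq_sq_add_X_mul_sq B
  obtain ⟨hA₁, hdegA₁, hdegA₀⟩ := natDegree_le_of_odd_natDegree_sq_add_X_mul_sq ha
  obtain ⟨-, hdegD, hdegE⟩ := natDegree_le_of_odd_natDegree_sq_add_X_mul_sq hb
  have hV := natDegree_div_eq_sub D hA₁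
  refine ⟨E + A₀ * (D / A₁), D / A₁, X * (D % A₁) ^ 2, ?_, ?_, by omega, ?_⟩
  · have hD : D ^ 2 = (A₁ * (D / A₁)) ^ 2 + (D % A₁) ^ 2 := by
      rw [← CharTwo.add_sq, EuclideanDomain.div_add_mod]
    rw [hD, CharTwo.add_sq]
    linear_combination -(A₀ * (D / A₁)) ^ 2 * CharTwo.two_eq_zero (R := k[X])
  · by_cases hR : D % A₁ = 0
    · simp [hR, ha]
    have hdegR := natDegree_lt_natDegree hR (degree_mod_lt D hA₁)
    rw [natDegree_X_mul (pow_ne_zero 2 hR), natDegree_pow]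
    omega
  · have hU := natDegree_add_le E (A₀ * (D / A₁))
    have hmul := natDegree_mul_le (p := A₀) (q := D / A₁)
    omega

theorem exists_isReducedTower [PerfectField k] (hA : Odd A.natDegree) (hB : Odd B.natDegree)
    {F : Type*} [Field F] [Algebra k[X] F] {ρ : F} (hρ : ρ ^ 2 + ρ = algebraMap k[X] F A) :
    ∃ U V p q : k[X], q.natDegree = max A.natDegree (B.natDegree - A.natDegree) ∧
      ∀ σ : F, σ ^ 2 + σ = ρ * algebraMap k[X] F A + algebraMap k[X] F B →
        IsReducedTower A p q ρ (σ + (algebraMap k[X] F U + algebraMap k[X] F V * ρ)) := by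
  obtain ⟨U, V, P, hUVP, hdegP, hdegV, hdegU⟩ := exists_eq_sq_add_sq_mul_add hA hB
  have hdegq := natDegree_add_sq_add hA V
  refine ⟨U, V, U + P, A + V ^ 2 + V, by rw [hdegq, hdegV], fun σ hσ =>
    ⟨hA, ne_zero_of_natDegree_gt (n := 0) ?_, ?_, hρ, ?_⟩⟩
  · rw [hdegq]
    exact lt_max_of_lt_left hA.pos
  · have := natDegree_add_le U P
    rw [hdegq]
    omega
  · have two : (2 : F) = 0 := by
      rw [← map_ofNat (algebraMap k[X] F), CharTwo.two_eq_zero, map_zero]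
    rw [hUVP] at hσ
    simp only [map_add, map_mul, map_pow] at hσ ⊢
    set u := algebraMap k[X] F U
    set v := algebraMap k[X] F V
    linear_combination hσ + v ^ 2 * hρ +
      (σ * (u + v * ρ) + u * v * ρ + u ^ 2 + v ^ 2 * algebraMap k[X] F A - v ^ 2 * ρ) * two

end Reduction

section Differentials

section Etale

variable (k S : Type*) [Field k] [CommRing S] [Algebra k S] [Algebra k[X] S]
  [IsScalarTower k k[X] S] [Algebra.FormallyEtale k[X] S]

/-- The coefficient of `dt`, as an isomorphism `Ω[S⁄k] ≃ S` for `S` étale over `k[t]`. -/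
def differentialEquiv : Ω[S⁄k] ≃ₗ[S] S :=
  (KaehlerDifferential.tensorKaehlerEquivOfFormallyEtale k k[X] S).symm ≪≫ₗ
    (LinearEquiv.baseChange k[X] S _ _ (KaehlerDifferential.polynomialEquiv k)) ≪≫ₗ
    TensorProduct.AlgebraTensorModule.rid k[X] S S

/-- The derivation `d/dt` of an étale `k[t]`-algebra. -/
def derivationT : Derivation k S S :=
  (differentialEquiv k S).toLinearMap.compDer (KaehlerDifferential.D k S)

variable {S}

theorem differentialEquiv_D (x : S) :
    differentialEquiv k S (KaehlerDifferential.D k S x) = derivationT k S x := rfl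

variable (S) in
theorem derivationT_X : derivationT k S (algebraMap k[X] S X) = 1 := by
  simp [← differentialEquiv_D, differentialEquiv,
    KaehlerDifferential.tensorKaehlerEquivOfFormallyEtale_symm_D_algebraMap]

theorem differentialEquiv_smul_D_X (ω : Ω[S⁄k]) :
    differentialEquiv k S ω • KaehlerDifferential.D k S (algebraMap k[X] S X) = ω := by
  apply (differentialEquiv k S).injective
  rw [map_smul, differentialEquiv_D, derivationT_X, smul_eq_mul, mul_one]

variable {k} in
theorem derivationT_algebraMap {F : Type*} [CommRing F] [Algebra k F] [Algebra k[X] F]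
    [IsScalarTower k k[X] F] [Algebra.FormallyEtale k[X] F] [Algebra S F]
    [IsScalarTower k S F] [IsScalarTower k[X] S F] (y : S) :
    derivationT k F (algebraMap S F y) = algebraMap S F (derivationT k S y) := by
  have hy := congrArg (KaehlerDifferential.map k k S F)
    (differentialEquiv_smul_D_X k (KaehlerDifferential.D k S y))
  rw [map_smul, KaehlerDifferential.map_D, KaehlerDifferential.map_D,
    ← IsScalarTower.algebraMap_apply, differentialEquiv_D, ← algebraMap_smul F] at hy
  rw [← differentialEquiv_D, ← hy, map_smul, differentialEquiv_D, derivationT_X, smul_eq_mul,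
    mul_one]

end Etale

theorem isRegularAt_smul_D {k F : Type*} [Field k] [Field F] [Algebra k F]
    {O : ValuationSubring F} {x y : F} (hx : x ∈ O) (hy : y ∈ O) :
    IsRegularAt k F O (x • KaehlerDifferential.D k F y) :=
  Submodule.smul_mem _ (⟨x, hx⟩ : O.toSubring) (Submodule.subset_span ⟨y, hy, rfl⟩)

variable {k F : Type*} [Field k] [Field F] [Algebra k F] [Algebra k[X] F] [IsScalarTower k k[X] F]
  [Algebra.FormallyEtale k[X] F] {O : ValuationSubring F}

theorem isRegularAt_iff_valuation_le {Γ : Type*} [LinearOrderedCommGroupWithZero Γ]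
    {w : Valuation F Γ} (hw : ∀ x, w x ≤ 1 ↔ x ∈ O) {π : F} (hπ : π ∈ O)
    (hπ0 : derivationT k F π ≠ 0)
    (hle : ∀ x ∈ O, w (derivationT k F x) ≤ w (derivationT k F π)) {ω : Ω[F⁄k]} :
    IsRegularAt k F O ω ↔ w (differentialEquiv k F ω) ≤ w (derivationT k F π) := by
  constructor
  · refine Submodule.span_induction
      (p := fun ω _ => w (differentialEquiv k F ω) ≤ w (derivationT k F π)) ?_ ?_ ?_ ?_
    · rintro _ ⟨x, hx, rfl⟩
      exact hle x hx
    · simp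
    · intro η θ _ _ hη hθ
      rw [map_add]
      exact w.map_add_le hη hθ
    · intro a η _ hη
      have hsmul : differentialEquiv k F (a • η) = (a : F) * differentialEquiv k F η :=
        map_smul (differentialEquiv k F) (a : F) η
      rw [hsmul, map_mul]
      exact mul_le_of_le_one_of_le ((hw _).mpr a.2) hη
  · intro hω
    have hdiv : differentialEquiv k F ω / derivationT k F π ∈ O := by
      rw [← hw, map_div₀]
      exact div_le_one_of_le₀ hω zero_le
    convert isRegularAt_smul_D (k := k) hdiv hπ
    apply (differentialEquiv k F).injective
    rw [map_smul, differentialEquiv_D, smul_eq_mul, div_mul_cancel₀ _ hπ0]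

variable {R : Type*} [CommRing R] [IsDedekindDomain R] [Algebra k R] [Algebra k[X] R]
  [IsScalarTower k k[X] R] [Algebra.FormallyEtale k[X] R] [Algebra R F] [IsScalarTower k R F]
  [IsScalarTower k[X] R F] [IsFractionRing R F]

theorem valuation_derivationT_le_one (v : IsDedekindDomain.HeightOneSpectrum R) {x : F}
    (hx : v.valuation F x ≤ 1) : v.valuation F (derivationT k F x) ≤ 1 := by
  obtain ⟨n, d, hnd⟩ := v.exists_primeCompl_mul_eq_of_integer x hx
  have hd : v.valuation F (algebraMap R F d) = 1 := v.valuation_eq_one_iff_notMem.mpr d.2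
  have leibniz := congrArg (derivationT k F) hnd
  rw [Derivation.leibniz, smul_eq_mul, smul_eq_mul, derivationT_algebraMap,
    derivationT_algebraMap] at leibniz
  have hle : v.valuation F (algebraMap R F d * derivationT k F x) ≤ 1 := by
    rw [eq_sub_of_add_eq' leibniz]
    refine Valuation.map_sub_le _ (v.valuation_le_one _) ?_
    rw [map_mul]
    exact mul_le_one' hx (v.valuation_le_one _)
  rwa [map_mul, hd, one_mul] at hle

theorem differentialEquiv_mem_range_of_isRegularAt {ω : Ω[F⁄k]}
    (hω : ∀ O : ValuationSubring F, (∀ y : R, algebraMap R F y ∈ O) → IsRegularAt k F O ω) :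
    differentialEquiv k F ω ∈ Set.range (algebraMap R F) := by
  refine IsDedekindDomain.HeightOneSpectrum.mem_integers_of_valuation_le_one F _ fun v => ?_
  have ht1 : derivationT k F (algebraMap k[X] F X) = 1 := derivationT_X k F
  have := (isRegularAt_iff_valuation_le (w := v.valuation F)
    (O := (v.valuation F).valuationSubring) (fun _ => Iff.rfl) (π := algebraMap k[X] F X)
    (by rw [IsScalarTower.algebraMap_apply k[X] R F]; exact v.valuation_le_one _)
    (by rw [ht1]; exact one_ne_zero)
    (fun x hx => by rw [ht1, map_one]; exact valuation_derivationT_le_one v hx)).mp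
    (hω _ fun y => v.valuation_le_one y)
  rwa [ht1, map_one] at this

theorem isRegularAt_of_differentialEquiv_mem {ω : Ω[F⁄k]} (ht : algebraMap k[X] F X ∈ O)
    (hω : differentialEquiv k F ω ∈ O) : IsRegularAt k F O ω :=
  differentialEquiv_smul_D_X k ω ▸ isRegularAt_smul_D hω ht

end Differentials

section Genus

theorem algebraMap_mem_of_isIntegral {P R F : Type*} [CommRing P] [CommRing R] [Field F]
    [Algebra P R] [Algebra R F] [Algebra P F] [IsScalarTower P R F] {O : ValuationSubring F}
    (hO : ∀ c : P, algebraMap P F c ∈ O) {y : R} (hy : IsIntegral P y) : algebraMap R F y ∈ O := by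
  have hint : IsIntegral O.valuation.integer (algebraMap R F y) :=
    hy.map_of_comp_eq ((algebraMap P F).codRestrict O.valuation.integer fun c =>
      (O.valuation_le_one_iff _).mpr (hO c)) (algebraMap R F)
      (RingHom.ext fun c => IsScalarTower.algebraMap_apply P R F c)
  exact (O.valuation_le_one_iff _).mp
    ((Valuation.integer.integers O.valuation).mem_of_integral hint)

theorem algebraMap_eq_sum_repr {P R F ι : Type*} [CommRing P] [CommRing R] [CommRing F]
    [Algebra P R] [Algebra R F] [Algebra P F] [IsScalarTower P R F] [Fintype ι]
    (b : Module.Basis ι P R) (z : R) :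
    algebraMap R F z = ∑ i, algebraMap P F (b.repr z i) * algebraMap R F (b i) := by
  conv_lhs => rw [← b.sum_repr z, map_sum]
  refine Finset.sum_congr rfl fun i _ => ?_
  rw [Algebra.smul_def, map_mul, ← IsScalarTower.algebraMap_apply]

variable {k F R : Type*} [Field k] [Field F] [Algebra k F] [Algebra k[X] F] [IsScalarTower k k[X] F]

theorem algebraMap_polynomial_mem {O : ValuationSubring F} (hO : ∀ c : k, algebraMap k F c ∈ O)
    (ht : algebraMap k[X] F X ∈ O) (f : k[X]) : algebraMap k[X] F f ∈ O := by
  rw [algebraMap_eq_aeval, aeval_eq_sum_range]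
  exact sum_mem fun i _ => Algebra.smul_def (A := F) (f.coeff i) _ ▸ mul_mem (hO _) (pow_mem ht i)

variable [Algebra.FormallyEtale k[X] F] [CommRing R] [Algebra k[X] R] [Algebra R F]

theorem genus_eq_sum_of_basis [Algebra k R] [IsScalarTower k k[X] R] [IsScalarTower k R F]
    [FaithfulSMul R F] {ι : Type*} [Fintype ι] (b : Module.Basis ι k[X] R) (n : ι → ℕ)
    (h : ∀ ω : Ω[F⁄k], ω ∈ regularDifferentials k F ↔ ∃ z : R,
      algebraMap R F z = differentialEquiv k F ω ∧ ∀ i, b.repr z i ∈ degreeLT k (n i)) :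
    genus k F = ∑ i, n i := by
  let coordinates : (∀ i, degreeLT k (n i)) →ₗ[k] ι → k[X] :=
    LinearMap.piMap fun i => (degreeLT k (n i)).subtype
  let φ : (∀ i, degreeLT k (n i)) →ₗ[k] Ω[F⁄k] :=
    ((differentialEquiv k F).symm.restrictScalars k).toLinearMap ∘ₗ
      (IsScalarTower.toAlgHom k R F).toLinearMap ∘ₗ
      (b.equivFun.symm.restrictScalars k).toLinearMap ∘ₗ coordinates
  have hφ (f) : differentialEquiv k F (φ f) = algebraMap R F (b.equivFun.symm fun i => f i) :=
    (differentialEquiv k F).apply_symm_apply _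
  have hinj : Function.Injective φ := fun f g hfg => by
    have hfg' := congrArg (differentialEquiv k F) hfg
    rw [hφ, hφ] at hfg'
    have hcoord := b.equivFun.symm.injective (FaithfulSMul.algebraMap_injective R F hfg')
    exact funext fun i => Subtype.ext (congrFun hcoord i)
  have hrange : LinearMap.range φ = regularDifferentials k F := by
    ext ω
    rw [h]
    constructor
    · rintro ⟨f, rfl⟩
      exact ⟨_, (hφ f).symm, fun i => by
        simpa only [← b.equivFun_apply, LinearEquiv.apply_symm_apply] using (f i).2⟩
    · rintro ⟨z, hz, hdeg⟩
      refine ⟨fun i => ⟨b.repr z i, hdeg i⟩, (differentialEquiv k F).injective ?_⟩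
      rw [hφ, ← hz]
      exact congrArg (algebraMap R F) (b.equivFun.symm_apply_apply z)
  have hfin (m : ℕ) : Module.Finite k (degreeLT k m) := .equiv (degreeLTEquiv k m).symm
  rw [genus, ← hrange, LinearMap.finrank_range_of_inj hinj, Module.finrank_pi_fintype]
  simp_rw [(degreeLTEquiv k _).finrank_eq, Module.finrank_fin_fun]

namespace IsReducedTower

variable [CharP k 2] [IsScalarTower k[X] R F] [IsFractionRing R F]
  {A p q : k[X]} {r s : F}
  (h : IsReducedTower A p q r s) (b : Module.Basis (Fin 4) k[X] R)
  (hb : ∀ i, algebraMap R F (b i) = towerBasis r s i)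

include h hb

theorem hasOddDlogSize_univ {Γ : Type*} [LinearOrderedCommGroupWithZero Γ] {w : Valuation F Γ}
    [w.IsTrivialOn k] {γ : Γ} (hγ : 1 < γ) (ht : w (algebraMap k[X] F X) = γ ^ (4 : ℤ)) :
    HasOddDlogSize w γ (derivationT k F) 1 (γ ^ (2 * q.natDegree + 3 * A.natDegree - 4 : ℤ))
      Set.univ := by
  have := charP_of_injective_algebraMap (algebraMap k F).injective 2
  refine ((h.hasOddDlogSize hγ ht (derivationT_X k F)).mono ?_).of_isFractionRing (R := R) hγ
  rintro _ ⟨y, rfl⟩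
  rw [algebraMap_eq_sum_repr b]
  simp only [hb, sum_towerBasis_eq]
  exact ⟨_, ⟨_, ⟨_, rfl⟩, _, ⟨_, rfl⟩, rfl⟩, _, ⟨_, ⟨_, rfl⟩, _, ⟨_, rfl⟩, rfl⟩, rfl⟩

theorem isRegularAt_iff_of_notMem {O : ValuationSubring F} (hO : ∀ c : k, algebraMap k F c ∈ O)
    (ht : algebraMap k[X] F X ∉ O) {ω : Ω[F⁄k]} {z : R}
    (hz : algebraMap R F z = differentialEquiv k F ω) :
    IsRegularAt k F O ω ↔ ∀ i, b.repr z i ∈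
      degreeLT k ((2 * q.natDegree + 3 * A.natDegree - 1 - towerPole A q i) / 4) := by
  obtain ⟨w, γ, _, hγ, hwt, hw⟩ := exists_valuation_eq_zpow_of_notMem hO ht four_ne_zero
  obtain ⟨π, hπ⟩ := h.exists_uniformizer hγ hwt
  have dlog := h.hasOddDlogSize_univ b hb hγ hwt
  have hδπ := dlog.valuation_derivation_uniformizer hγ hπ
  have hA := h.odd.pos
  rw [isRegularAt_iff_valuation_le hw ((hw π).mp (hπ ▸ zpow_le_one_of_nonpos₀ hγ.le (by decide)))
    (w.ne_zero_iff.mp (hδπ ▸ zpow_ne_zero _ (zero_lt_one.trans hγ).ne'))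
    (fun x hx => hδπ ▸ dlog.valuation_derivation_le hγ ((hw x).mpr hx)), hδπ, ← hz,
    algebraMap_eq_sum_repr b]
  simp only [hb]
  rw [h.valuation_sum_le_iff hγ hwt]
  refine forall_congr' fun i => ?_
  rw [valuation_algebraMap_mul_le_iff hγ hwt (h.valuation_towerBasis hγ hwt i),
    mem_degreeLT_div_iff four_pos]
  refine or_congr_right ?_
  omega

theorem mem_regularDifferentials_iff [IsDedekindDomain R] [Algebra k R] [IsScalarTower k k[X] R]
    [IsScalarTower k R F] [Algebra.FormallyEtale k[X] R] {ω : Ω[F⁄k]} :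
    ω ∈ regularDifferentials k F ↔ ∃ z : R, algebraMap R F z = differentialEquiv k F ω ∧
      ∀ i, b.repr z i ∈
        degreeLT k ((2 * q.natDegree + 3 * A.natDegree - 1 - towerPole A q i) / 4) := by
  constructor
  · intro hω
    obtain ⟨z, hz⟩ := differentialEquiv_mem_range_of_isRegularAt (R := R) fun O hO =>
      hω O fun c => IsScalarTower.algebraMap_apply k R F c ▸ hO _
    have hinj : Function.Injective (algebraMap k[X] F) := by
      rw [IsScalarTower.algebraMap_eq k[X] R F]
      exact (IsFractionRing.injective R F).comp b.algebraMap_injective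
    obtain ⟨O, hO, ht⟩ := exists_valuationSubring_notMem (not_isIntegral_algebraMap_X hinj)
    exact ⟨z, hz, (h.isRegularAt_iff_of_notMem b hb hO ht hz).mp (hω O hO)⟩
  · rintro ⟨z, hz, hdeg⟩ O hO
    by_cases ht : algebraMap k[X] F X ∈ O
    · have := Module.Finite.of_basis b
      refine isRegularAt_of_differentialEquiv_mem ht (hz ▸ ?_)
      exact algebraMap_mem_of_isIntegral (algebraMap_polynomial_mem hO ht)
        (Algebra.IsIntegral.isIntegral z)
    · exact (h.isRegularAt_iff_of_notMem b hb hO ht hz).mpr hdeg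

theorem genus_eq [IsDedekindDomain R] [Algebra k R] [IsScalarTower k k[X] R] [IsScalarTower k R F]
    [Algebra.FormallyEtale k[X] R] :
    genus k F = ∑ i, (2 * q.natDegree + 3 * A.natDegree - 1 - towerPole A q i) / 4 :=
  have := (faithfulSMul_iff_algebraMap_injective R F).mpr (IsFractionRing.injective R F)
  genus_eq_sum_of_basis b _ fun _ => h.mem_regularDifferentials_iff b hb

end IsReducedTower

end Genus

section GenusOfTower

variable {k F R : Type*} [Field k] [Field F] [Algebra k F] [Algebra k[X] F] [IsScalarTower k k[X] F]
  [CommRing R] [Algebra k[X] R] [Algebra R F] [IsScalarTower k[X] R F] {A B p q : k[X]} {ρ σ : R}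

theorem IsReducedTower.exists_basis
    (h : IsReducedTower A p q (algebraMap R F ρ) (algebraMap R F σ))
    (hinj : Function.Injective (algebraMap k[X] F))
    (hspan : ∀ y : R, ∃ f : Fin 4 → k[X], ∑ i, algebraMap k[X] R (f i) * towerBasis ρ σ i = y) :
    ∃ b : Module.Basis (Fin 4) k[X] R, ∀ i, b i = towerBasis ρ σ i := by
  obtain ⟨O, w, γ, _, hγ, ht⟩ := exists_valuation_X_eq_zpow (k := k) hinj four_ne_zero
  have hli : LinearIndependent k[X] (towerBasis ρ σ) :=
    .of_comp (IsScalarTower.toAlgHom k[X] R F).toLinearMap (by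
      convert h.linearIndependent hγ ht using 1
      exact funext (map_towerBasis (algebraMap R F) ρ σ))
  have htop : ⊤ ≤ Submodule.span k[X] (Set.range (towerBasis ρ σ)) := fun y _ => by
    obtain ⟨f, rfl⟩ := hspan y
    simp only [← Algebra.smul_def]
    exact Submodule.sum_mem _ fun i _ => Submodule.smul_mem _ _ (Submodule.subset_span ⟨i, rfl⟩)
  exact ⟨.mk hli htop, Module.Basis.mk_apply hli htop⟩

theorem exists_genus_eq_of_tower [CharP k 2] [PerfectField k] [Algebra k R] [IsScalarTower k k[X] R]
    [IsScalarTower k R F] [IsDedekindDomain R] [IsFractionRing R F] [Algebra.FormallyEtale k[X] R]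
    [Algebra.FormallyEtale k[X] F] (hinj : Function.Injective (algebraMap k[X] R))
    (hA : Odd A.natDegree) (hB : Odd B.natDegree) (hρ : ρ ^ 2 + ρ = algebraMap k[X] R A)
    (hσ : σ ^ 2 + σ = ρ * algebraMap k[X] R A + algebraMap k[X] R B)
    (hspan : ∀ y : R, ∃ f : Fin 4 → k[X], ∑ i, algebraMap k[X] R (f i) * towerBasis ρ σ i = y) :
    ∃ q : k[X], q.natDegree = max A.natDegree (B.natDegree - A.natDegree) ∧
      genus k F = ∑ i, (2 * q.natDegree + 3 * A.natDegree - 1 - towerPole A q i) / 4 := by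
  have map_root := congrArg (algebraMap R F) hρ
  have map_root' := congrArg (algebraMap R F) hσ
  simp only [map_add, map_mul, map_pow, ← IsScalarTower.algebraMap_apply] at map_root map_root'
  obtain ⟨U, V, p, q, hq, tower⟩ := exists_isReducedTower hA hB map_root
  have h : IsReducedTower A p q (algebraMap R F ρ)
      (algebraMap R F (σ + (algebraMap k[X] R U + algebraMap k[X] R V * ρ))) := by
    simpa only [map_add, map_mul, ← IsScalarTower.algebraMap_apply] using tower _ map_root'
  have hinj' : Function.Injective (algebraMap k[X] F) := by
    rw [IsScalarTower.algebraMap_eq k[X] R F]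
    exact (IsFractionRing.injective R F).comp hinj
  obtain ⟨b, hb⟩ := h.exists_basis hinj' fun y => by
    obtain ⟨f, rfl⟩ := hspan y
    exact exists_sum_towerBasis_add_eq hρ σ U V f
  exact ⟨q, hq, h.genus_eq b fun i => by rw [hb, map_towerBasis]⟩

end GenusOfTower

section ArtinSchreierAlgebra

theorem prime_of_monic_of_prime_map {R K : Type*} [CommRing R] [CommRing K] {φ : R →+* K}
    (hφ : Function.Injective φ) {f : R[X]} (hf : f.Monic) (h : Prime (f.map φ)) : Prime f := by
  refine ⟨?_, fun hu => h.not_isUnit (hu.map (mapRingHom φ)), fun a b hab => ?_⟩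
  · rintro rfl
    exact h.ne_zero (Polynomial.map_zero φ)
  · rw [← map_dvd_map φ hφ hf, Polynomial.map_mul] at hab
    rw [← map_dvd_map φ hφ hf, ← map_dvd_map φ hφ hf]
    exact h.dvd_or_dvd hab

theorem formallyEtale_adjoinRoot_of_separable {R : Type*} [CommRing R] {f : R[X]} (hf : f.Monic)
    (h : f.Separable) : Algebra.FormallyEtale R (AdjoinRoot f) := by
  obtain ⟨a, b, hab⟩ := h
  let P : StandardEtalePair R := ⟨f, hf, 1, ⟨b, a, 0, by linear_combination hab⟩⟩
  have hunit : IsUnit (AdjoinRoot.mk f P.g) := (map_one (AdjoinRoot.mk f)).symm ▸ isUnit_one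
  have := IsLocalization.away_of_isUnit_of_bijective (AdjoinRoot f) hunit Function.bijective_id
  exact .of_equiv (P.equivAwayAdjoinRoot.trans
    ((IsLocalization.algEquiv (Submonoid.powers (AdjoinRoot.mk f P.g)) _
      (AdjoinRoot f)).restrictScalars R))

variable {H : Type*} [CommRing H] (c : H)

theorem artinSchreier_natDegree [Nontrivial H] : (X ^ 2 + X - C c : H[X]).natDegree = 2 := by
  compute_degree!

theorem artinSchreier_monic : (X ^ 2 + X - C c : H[X]).Monic := by
  nontriviality H
  rw [add_sub_assoc]
  exact monic_X_pow_add (by compute_degree!)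

theorem artinSchreier_root_sq_add_root :
    AdjoinRoot.root (X ^ 2 + X - C c) ^ 2 + AdjoinRoot.root (X ^ 2 + X - C c) =
      AdjoinRoot.of (X ^ 2 + X - C c) c := by
  have h := AdjoinRoot.eval₂_root (X ^ 2 + X - C c)
  simp only [eval₂_sub, eval₂_add, eval₂_pow, eval₂_X, eval₂_C] at h
  exact sub_eq_zero.mp h

theorem artinSchreier_exists_eq [Nontrivial H] (y : AdjoinRoot (X ^ 2 + X - C c)) :
    ∃ a b : H, y = AdjoinRoot.of _ a + AdjoinRoot.of _ b * AdjoinRoot.root _ := by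
  obtain ⟨g, rfl⟩ := AdjoinRoot.mk_surjective y
  have hm := artinSchreier_monic c
  have hdeg : (g %ₘ (X ^ 2 + X - C c)).natDegree ≤ 1 := by
    refine Nat.le_of_lt_succ ((natDegree_modByMonic_lt g hm fun h => ?_).trans_eq
      (artinSchreier_natDegree c))
    simpa [h] using artinSchreier_natDegree c
  refine ⟨(g %ₘ (X ^ 2 + X - C c)).coeff 0, (g %ₘ (X ^ 2 + X - C c)).coeff 1, ?_⟩
  rw [← AdjoinRoot.mk_leftInverse hm (AdjoinRoot.mk _ g), AdjoinRoot.modByMonicHom_mk,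
    eq_X_add_C_of_natDegree_le_one hdeg]
  simp [add_comm]

theorem artinSchreier_prime {K : Type*} [Field K] [Algebra H K] [FaithfulSMul H K]
    (h : ∀ z : K, z ^ 2 + z ≠ algebraMap H K c) : Prime (X ^ 2 + X - C c : H[X]) := by
  refine prime_of_monic_of_prime_map (FaithfulSMul.algebraMap_injective H K)
    (artinSchreier_monic c) (Irreducible.prime ?_)
  simp only [Polynomial.map_sub, Polynomial.map_add, Polynomial.map_pow, map_X, map_C]
  refine irreducible_of_degree_le_three_of_not_isRoot ?_ fun z hz => h z ?_
  · rw [artinSchreier_natDegree]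
    decide
  · simpa [sub_eq_zero] using hz

theorem artinSchreier_of_injective : Function.Injective (AdjoinRoot.of (X ^ 2 + X - C c)) := by
  nontriviality H
  refine (injective_iff_map_eq_zero _).mpr fun a ha => C_eq_zero.mp ?_
  by_contra h
  refine (artinSchreier_monic c).not_dvd_of_natDegree_lt h ?_ (AdjoinRoot.mk_eq_zero.mp ha)
  rw [natDegree_C, artinSchreier_natDegree]
  decide

theorem artinSchreier_separable [CharP H 2] : (X ^ 2 + X - C c : H[X]).Separable :=
  ⟨0, 1, by simp [CharTwo.add_self_eq_zero]⟩

instance artinSchreier_finite : Module.Finite H (AdjoinRoot (X ^ 2 + X - C c)) :=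
  (artinSchreier_monic c).finite_adjoinRoot

instance artinSchreier_formallyEtale [CharP H 2] :
    Algebra.FormallyEtale H (AdjoinRoot (X ^ 2 + X - C c)) :=
  formallyEtale_adjoinRoot_of_separable (artinSchreier_monic c) (artinSchreier_separable c)

end ArtinSchreierAlgebra

section Curve

variable {k : Type*} [Field k] {A B : k[X]}

theorem isDomain_coordRingH (hA : Odd A.natDegree) : IsDomain (CoordRingH A) := by
  refine AdjoinRoot.isDomain_of_prime
    (artinSchreier_prime (K := FractionRing k[X]) A fun z hz => ?_)
  obtain ⟨O, w, γ, _, hγ, ht⟩ := exists_valuation_X_eq_zpow (k := k)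
    (IsFractionRing.injective k[X] (FractionRing k[X])) four_ne_zero
  have orders : OrdersDivisibleBy w γ (2 * 2) Set.univ :=
    (ordersDivisibleBy_polynomial hγ four_pos ht).of_isFractionRing hγ
  exact orders.valuation_ne_of_odd hγ two_ne_zero (by exact_mod_cast hA) trivial
    (valuation_root_of_odd hγ ht hA hz)

theorem algebraMap_coordRingH_injective :
    Function.Injective (algebraMap k[X] (CoordRingH A)) :=
  artinSchreier_of_injective A

theorem algebraMap_coordRingH_mem_quadraticExtension {F : Type*} [Field F] [Algebra k[X] F]
    [Algebra (CoordRingH A) F] [IsScalarTower k[X] (CoordRingH A) F] (y : CoordRingH A) :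
    algebraMap (CoordRingH A) F y ∈ quadraticExtension (Set.range (algebraMap k[X] F))
      (algebraMap (CoordRingH A) F (r A)) := by
  obtain ⟨f, g, rfl⟩ := artinSchreier_exists_eq A y
  refine ⟨_, ⟨f, rfl⟩, _, ⟨g, rfl⟩, ?_⟩
  rw [map_add, map_mul, IsScalarTower.algebraMap_apply k[X] (CoordRingH A) F,
    IsScalarTower.algebraMap_apply k[X] (CoordRingH A) F]
  rfl

theorem algebraMap_r_sq_add_self {S : Type*} [CommRing S] [Algebra k[X] S]
    [Algebra (CoordRingH A) S] [IsScalarTower k[X] (CoordRingH A) S] :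
    algebraMap (CoordRingH A) S (r A) ^ 2 + algebraMap (CoordRingH A) S (r A) =
      algebraMap k[X] S A := by
  rw [← map_pow, ← map_add, artinSchreier_root_sq_add_root,
    IsScalarTower.algebraMap_apply k[X] (CoordRingH A)]
  rfl

theorem exists_eq_sum_towerBasis (y : CoordRingC A B) : ∃ f : Fin 4 → k[X],
    ∑ i, algebraMap k[X] (CoordRingC A B) (f i) *
      towerBasis (AdjoinRoot.of _ (r A)) (AdjoinRoot.root _) i = y := by
  have : Nontrivial (CoordRingH A) := algebraMap_coordRingH_injective.nontrivial
  obtain ⟨a, b, rfl⟩ := artinSchreier_exists_eq _ y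
  obtain ⟨f₀, f₁, rfl⟩ := artinSchreier_exists_eq A a
  obtain ⟨g₀, g₁, rfl⟩ := artinSchreier_exists_eq A b
  refine ⟨![f₀, f₁, g₀, g₁], ?_⟩
  rw [sum_towerBasis_eq]
  simp only [map_add, map_mul]
  rfl

theorem algebraMap_coordRingC_injective :
    Function.Injective (algebraMap k[X] (CoordRingC A B)) := by
  have hof := artinSchreier_of_injective (r A * AdjoinRoot.of _ A + AdjoinRoot.of _ B)
  have hcomp := hof.comp (algebraMap_coordRingH_injective (A := A))
  exact hcomp

theorem root_sq_add_self : (AdjoinRoot.root _ : CoordRingC A B) ^ 2 + AdjoinRoot.root _ =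
    AdjoinRoot.of _ (r A) * algebraMap k[X] (CoordRingC A B) A +
      algebraMap k[X] (CoordRingC A B) B := by
  refine (artinSchreier_root_sq_add_root _).trans ?_
  simp only [map_add, map_mul]
  rfl

instance : Module.Finite k[X] (CoordRingC A B) := .trans (CoordRingH A) _

variable [CharP k 2]

instance : CharP (CoordRingH A) 2 :=
  charP_of_injective_algebraMap algebraMap_coordRingH_injective 2

instance : Algebra.FormallyEtale k[X] (CoordRingC A B) := .comp k[X] (CoordRingH A) _

variable [PerfectField k]

theorem isDomain_coordRingC (hA : Odd A.natDegree) (hB : Odd B.natDegree) :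
    IsDomain (CoordRingC A B) := by
  have := isDomain_coordRingH hA
  let K := FractionRing (CoordRingH A)
  refine AdjoinRoot.isDomain_of_prime (artinSchreier_prime (K := K) _ fun z hz => ?_)
  have hinj : Function.Injective (algebraMap k[X] K) := by
    rw [IsScalarTower.algebraMap_eq k[X] (CoordRingH A) K]
    exact (IsFractionRing.injective (CoordRingH A) K).comp algebraMap_coordRingH_injective
  obtain ⟨O, w, γ, _, hγ, ht⟩ := exists_valuation_X_eq_zpow (k := k) hinj four_ne_zero
  obtain ⟨U, V, p, q, -, tower⟩ :=
    exists_isReducedTower hA hB (algebraMap_r_sq_add_self (S := K))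
  have h := tower z (by
    rw [hz, map_add, map_mul, IsScalarTower.algebraMap_apply k[X] (CoordRingH A) K,
      IsScalarTower.algebraMap_apply k[X] (CoordRingH A) K]
    rfl)
  have orders : OrdersDivisibleBy w γ (2 * 1) Set.univ :=
    ((ordersDivisibleBy_quadraticExtension_polynomial hγ ht hA h.sq_add_self_left).mono
      (Set.range_subset_iff.mpr algebraMap_coordRingH_mem_quadraticExtension)).of_isFractionRing
      (R := CoordRingH A) hγ
  have hσ := h.valuation_right hγ ht
  rw [← one_mul (2 * (q.natDegree : ℤ) + A.natDegree)] at hσ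
  exact orders.valuation_ne_of_odd hγ one_ne_zero h.odd_pole_right trivial hσ

theorem exists_genus_eq [IsDomain (CoordRingC A B)] (hA : Odd A.natDegree)
    (hB : Odd B.natDegree) :
    ∃ q : k[X], q.natDegree = max A.natDegree (B.natDegree - A.natDegree) ∧
      genus k (FractionRing (CoordRingC A B)) =
        ∑ i, (2 * q.natDegree + 3 * A.natDegree - 1 - towerPole A q i) / 4 := by
  let R := CoordRingC A B
  let F := FractionRing R
  have : IsDedekindDomain R := isDedekindDomain.of_formallyUnramified k[X] R
  have : Algebra.FormallyEtale R F := .of_isLocalization (nonZeroDivisors R)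
  have : Algebra.FormallyEtale k[X] F := .comp k[X] R F
  exact exists_genus_eq_of_tower (R := R) (F := F) (ρ := AdjoinRoot.of _ (r A))
    (σ := AdjoinRoot.root _) algebraMap_coordRingC_injective hA hB
    algebraMap_r_sq_add_self root_sq_add_self exists_eq_sum_towerBasis

theorem two_mul_genus_add_three [IsDomain (CoordRingC A B)] (hA : Odd A.natDegree)
    (hB : Odd B.natDegree) :
    2 * genus k (FractionRing (CoordRingC A B)) + 3 =
      max (5 * A.natDegree) (2 * B.natDegree + A.natDegree) := by
  obtain ⟨q, hq, hg⟩ := exists_genus_eq hA hB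
  obtain ⟨a, ha⟩ := hA
  obtain ⟨b, hb⟩ := hB
  rw [hg, Fin.sum_univ_four]
  simp only [towerPole, Matrix.cons_val]
  omega

end Curve

end ArtinSchreierQuartic

end

theorem mainTheorem7 {k : Type*} [Field k] [PerfectField k] [CharP k 2] (A B : k[X])
    (hA : Odd A.natDegree) (hB : Odd B.natDegree) :
    ∃ _ : IsDomain (ArtinSchreierQuartic.CoordRingC A B),
      (ArtinSchreierQuartic.genus k (FractionRing (ArtinSchreierQuartic.CoordRingC A B)) : ℚ) =
        max ((5 * (A.natDegree : ℚ) - 3) / 2)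
          ((2 * (B.natDegree : ℚ) + (A.natDegree : ℚ) - 3) / 2) := by
  have hdom := ArtinSchreierQuartic.isDomain_coordRingC hA hB
  refine ⟨hdom, ?_⟩
  have hgenus := congrArg (Nat.cast (R := ℚ))
    (ArtinSchreierQuartic.two_mul_genus_add_three hA hB)
  push_cast at hgenus
  rw [max_div_div_right (by norm_num : (0 : ℚ) ≤ 2), max_sub_sub_right, ← hgenus]
  ring
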